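/- Let $\mathbf u=(u_1,\dots,u_n)\in\mathbb R^n$ with $0\le u_1\le\cdots\le u_n$. A vector $\mathbf a\in\mathbb R_{\ge0}^n$ with non-decreasing rearrangement $b_1\le\cdots\le b_n$ is a $\mathbf u$-parking function if $b_i\le u_i$ for all $i$; let $\mathrm{PF}(\mathbf u)\subset\mathbb R^n$ be the convex hull of all $\mathbf u$-parking functions. For a set $I$ of indices put $\Delta_I=\mathrm{conv}(\mathbf e_i : i\in I)$ and $\Delta^0_I=\mathrm{conv}(\mathbf 0,\Delta_I)$, and for $\emptyset\ne I\subseteq[n]$ put \[ y_I=\sum_{j=0}^{|I|-1}\binom{|I|-1}{j}(-1)^j\,u_{|I|-j}. \] A polytope $P$ is said to be the signed Minkowski sum $\sum_I y_I K_I$ of polytopes $K_I$ if $P+\sum_{y_I<0}(-y_I)K_I=\sum_{y_I>0}y_I K_I$ as ordinary Minkowski sums. A type $A$ generalized permutohedron is a polytope each of whose edges is parallel to $\mathbf e_i-\mathbf e_j$ for some $i\ne j$. Then the following hold. (1) $\mathrm{PF}(\mathbf u)$ is a polytope, and as a signed Minkowski sum \[ \mathrm{PF}(\mathbf u)=\sum_{\emptyset\ne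 I\subseteq[n]} y_I\,\Delta^0_I , \] where $y_I$ depends only on $|I|$. (2) There is a type $A$ generalized permutohedron $Q\subset\mathbb R^{\{0,1,\dots,n\}}$ that is the signed Minkowski sum \[ Q=\sum_{\emptyset\ne I\subseteq[n]} y_I\,\Delta_{\{0\}\cup I}, \] and the projection $\pi(x_0,x_1,\dots,x_n)=(x_1,\dots,x_n)$ satisfies $\pi(Q)=\mathrm{PF}(\mathbf u)$ and maps the affine hull of $Q$ bijectively onto that of $\mathrm{PF}(\mathbf u)$. (3) If $\mathrm{PF}(\mathbf u)$ is integral (all its vertices have integer coordinates), then all $y_I$ are integers, $Q$ is integral, and $\pi$ restricts to a bijection from the integer points of the affine hull of $Q$ to those of the affine hull of $\mathrm{PF}(\mathbf u)$. In particular, $\mathrm{PF}(\mathbf u)$ and $Q$ are integrally equivalent: there is an affine bijection between their affine hulls, carrying one polytope onto the other and integer points of the affine hulls bijectively to integer points. -/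

import Mathlib

open scoped Pointwise

noncomputable section

namespace ParkingPolytope

/-- `a` is a `u`-parking function: its entries are nonnegative and its non-decreasing
rearrangement `b` satisfies `b i ≤ u i` for all `i`. -/
def IsParkingFunction {n : ℕ} (u a : Fin n → ℝ) : Prop :=
  (∀ i, 0 ≤ a i) ∧ ∀ i, a (Tuple.sort a i) ≤ u i

/-- The parking function polytope: the convex hull of all `u`-parking functions. -/
def PF {n : ℕ} (u : Fin n → ℝ) : Set (Fin n → ℝ) :=
  convexHull ℝ {a | IsParkingFunction u a}

/-- A polytope: the convex hull of finitely many points. -/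
def IsPolytope {ι : Type*} (P : Set (ι → ℝ)) : Prop :=
  ∃ S : Set (ι → ℝ), S.Finite ∧ P = convexHull ℝ S

/-- The points with integer coordinates. -/
def latticePoints (ι : Type*) : Set (ι → ℝ) :=
  {x | ∀ i, ∃ k : ℤ, x i = k}

/-- A polytope is integral if all its vertices are lattice points. -/
def IsIntegralPolytope {ι : Type*} (P : Set (ι → ℝ)) : Prop :=
  IsPolytope P ∧ P.extremePoints ℝ ⊆ latticePoints ι

/-- `Δ_I`, the convex hull of the `e_i` with `i ∈ I`. -/
def simplex {ι : Type*} [DecidableEq ι] (I : Finset ι) : Set (ι → ℝ) :=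
  convexHull ℝ ((fun i => (Pi.single i 1 : ι → ℝ)) '' (I : Set ι))

/-- `Δ⁰_I`, the convex hull of the origin and `Δ_I`. -/
def simplexZero {ι : Type*} [DecidableEq ι] (I : Finset ι) : Set (ι → ℝ) :=
  convexHull ℝ (insert 0 (simplex I))

/-- `P = ∑_{a ∈ s} y_a K_a` as a signed Minkowski sum: `P` is a polytope, and moving the
summands with negative coefficients to the side of `P` gives an identity between ordinary
Minkowski sums. (By cancellation there is at most one such `P` if the `K_a` are nonempty
polytopes.) -/
def IsSignedMinkowskiSum {α ι : Type*} (P : Set (ι → ℝ)) (s : Finset α) (y : α → ℝ)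
    (K : α → Set (ι → ℝ)) : Prop :=
  IsPolytope P ∧
    P + ∑ a ∈ s, max (-y a) 0 • K a = ∑ a ∈ s, max (y a) 0 • K a

/-- `y_I = ∑_{j=0}^{|I|-1} C(|I|-1, j) (-1)^j u_{|I|-j}`. The entry `u_k` of the `1`-based
vector `u` is the value of `u` at the index `k - 1` of `Fin n`. -/
def coeffY {n : ℕ} (u : Fin n → ℝ) (I : Finset (Fin n)) : ℝ :=
  ∑ j : Fin I.card, ((I.card - 1).choose j : ℝ) * (-1) ^ (j : ℕ) *
    u ⟨I.card - j - 1, by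
      have h₁ := j.isLt
      have h₂ := card_finset_fin_le I
      omega⟩

/-- The nonempty subsets of `[n]`. -/
def nonemptySubsets (n : ℕ) : Finset (Finset (Fin n)) :=
  Finset.univ.filter fun I => I.Nonempty

/-- The subset `{0} ∪ I` of `[0,n]`, for `I ⊆ [n]`; here `[0,n]` is `Fin (n + 1)` and `[n]` is
embedded in it by `Fin.succ`. -/
def withZero {n : ℕ} (I : Finset (Fin n)) : Finset (Fin (n + 1)) :=
  insert 0 (I.image Fin.succ)

/-- The projection `(x_0, x_1, …, x_n) ↦ (x_1, …, x_n)`. -/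
def proj (n : ℕ) : (Fin (n + 1) → ℝ) →ᵃ[ℝ] (Fin n → ℝ) :=
  (LinearMap.funLeft ℝ ℝ (Fin.succ : Fin n → Fin (n + 1))).toAffineMap

/-- An edge of `P`: a one-dimensional face, a face being the set of points of `P` where some
linear functional is maximal on `P`. -/
def IsEdge {ι : Type*} (P F : Set (ι → ℝ)) : Prop :=
  IsExposed ℝ P F ∧ Module.finrank ℝ (vectorSpan ℝ F) = 1

/-- A type `A` generalized permutohedron: a polytope all of whose edges are parallel to some
`e_i - e_j` with `i ≠ j`. -/
def IsTypeAGenPermutohedron {ι : Type*} [DecidableEq ι] (P : Set (ι → ℝ)) : Prop :=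
  IsPolytope P ∧ ∀ F, IsEdge P F → ∃ i j : ι, i ≠ j ∧
    vectorSpan ℝ F = Submodule.span ℝ {(Pi.single i 1 - Pi.single j 1 : ι → ℝ)}

/-- The affine map `φ` restricts to an integral equivalence from `P` to `Q`: it is a bijection
from `aff P` to `aff Q` that carries `P` to `Q` and the lattice points of `aff P` bijectively
to those of `aff Q`. -/
def IsIntegralEquivalence {ι κ : Type*} (φ : (ι → ℝ) →ᵃ[ℝ] (κ → ℝ))
    (P : Set (ι → ℝ)) (Q : Set (κ → ℝ)) : Prop :=
  Set.BijOn φ (affineSpan ℝ P) (affineSpan ℝ Q) ∧ φ '' P = Q ∧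
    Set.BijOn φ (affineSpan ℝ P ∩ latticePoints ι) (affineSpan ℝ Q ∩ latticePoints κ)

/-- Integral equivalence of two integral polytopes. (An affine map between the affine hulls
always extends to the ambient spaces.) -/
def IntegrallyEquivalent {ι κ : Type*} (P : Set (ι → ℝ)) (Q : Set (κ → ℝ)) : Prop :=
  IsIntegralPolytope P ∧ IsIntegralPolytope Q ∧
    ∃ φ : (ι → ℝ) →ᵃ[ℝ] (κ → ℝ), IsIntegralEquivalence φ P Q

end ParkingPolytope

end

open scoped Pointwise

namespace ParkingPolytope

/-! Compact convex sets with equal support functions coincide (`eq_of_forall_hasMax`). Let `σ` sort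
the functional `w`. By the rearrangement inequality its maximum on `PF u` is `∑ m, max (w (σ m)) 0 *
u m`, while on `simplexZero I` it is `max (w k) 0`, with `k` the element of `I` that `σ` ranks last.
Since `y_I` is the forward difference of `u` of order `|I| - 1` at the start, Newton's formula says
that the coefficients of all sets with last-ranked element `σ m` add up to `u m`; hence the support
functions agree.

`Q` is the copy of `PF u` in the hyperplane where the coordinates sum to `∑ u_i = ∑ y_I`. The map
`lift c` is additive in the level and the point together, and at level `1` it turns `Δ⁰_I` into
`Δ_{{0} ∪ I}`, so the Minkowski identity carries over. A functional with distinct entries has a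
unique maximizer on every simplex, hence on `Q` by cancellation. An edge in a direction other than
`e_i - e_j` would contradict this: its functional can be perturbed orthogonally to the edge until
all entries differ.

For integrality, `u` is itself a vertex of `PF u`, so its entries, the `y_I` and the level are
integers. -/

theorem isCompact_finsetSum {α ι : Type*} {s : Finset α} {K : α → Set (ι → ℝ)}
    (h : ∀ a ∈ s, IsCompact (K a)) : IsCompact (∑ a ∈ s, K a) := by
  classical
  induction s using Finset.induction_on with
  | empty => simp
  | insert a s ha ih =>
    rw [Finset.sum_insert ha]
    exact (h a (by simp)).add (ih fun b hb => h b (by simp [hb]))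

theorem IsPolytope.convex {ι : Type*} {P : Set (ι → ℝ)} (h : IsPolytope P) : Convex ℝ P := by
  obtain ⟨S, hS, rfl⟩ := h
  exact convex_convexHull ℝ S

theorem simplexZero_eq {ι : Type*} [DecidableEq ι] (I : Finset ι) : simplexZero I =
    convexHull ℝ (insert 0 ((fun i => (Pi.single i 1 : ι → ℝ)) '' (I : Set ι))) := by
  rw [simplexZero, simplex, Set.insert_eq, Set.insert_eq, convexHull_convexHull_union_right]

theorem isPolytope_simplexZero {ι : Type*} [DecidableEq ι] (I : Finset ι) : IsPolytope (simplexZero I) :=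
  ⟨_, (I.finite_toSet.image _).insert 0, simplexZero_eq I⟩

theorem IsPolytope.isCompact {ι : Type*} {P : Set (ι → ℝ)} (h : IsPolytope P) : IsCompact P := by
  obtain ⟨S, hS, rfl⟩ := h
  exact hS.isCompact_convexHull (𝕜 := ℝ)

/-! ### Support functions -/

section Support

variable {ι : Type*} [Fintype ι]

/-- `r` is the maximum of the linear functional `w ⬝ᵥ ·` on `P`. -/
def HasMax (w : ι → ℝ) (P : Set (ι → ℝ)) (r : ℝ) : Prop :=
  (∃ x ∈ P, w ⬝ᵥ x = r) ∧ ∀ x ∈ P, w ⬝ᵥ x ≤ r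

theorem HasMax.unique {w : ι → ℝ} {P : Set (ι → ℝ)} {r s : ℝ} (hr : HasMax w P r)
    (hs : HasMax w P s) : r = s := by
  obtain ⟨⟨x, hx, rfl⟩, hr⟩ := hr
  obtain ⟨⟨y, hy, rfl⟩, hs⟩ := hs
  exact le_antisymm (hs x hx) (hr y hy)

theorem HasMax.add {w : ι → ℝ} {P Q : Set (ι → ℝ)} {r s : ℝ} (hP : HasMax w P r)
    (hQ : HasMax w Q s) : HasMax w (P + Q) (r + s) := by
  obtain ⟨⟨x, hx, rfl⟩, hr⟩ := hP
  obtain ⟨⟨y, hy, rfl⟩, hs⟩ := hQ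
  refine ⟨⟨x + y, Set.add_mem_add hx hy, dotProduct_add _ _ _⟩, ?_⟩
  rintro _ ⟨a, ha, b, hb, rfl⟩
  simpa [dotProduct_add] using add_le_add (hr a ha) (hs b hb)

theorem HasMax.smul {w : ι → ℝ} {P : Set (ι → ℝ)} {r c : ℝ} (hc : 0 ≤ c) (hP : HasMax w P r) :
    HasMax w (c • P) (c * r) := by
  obtain ⟨⟨x, hx, rfl⟩, hr⟩ := hP
  refine ⟨⟨c • x, Set.smul_mem_smul_set hx, by simp [dotProduct_smul]⟩, ?_⟩
  rintro _ ⟨a, ha, rfl⟩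
  simpa [dotProduct_smul] using mul_le_mul_of_nonneg_left (hr a ha) hc

theorem HasMax.sum {α : Type*} {w : ι → ℝ} {s : Finset α} {P : α → Set (ι → ℝ)} {r : α → ℝ}
    (h : ∀ a ∈ s, HasMax w (P a) (r a)) : HasMax w (∑ a ∈ s, P a) (∑ a ∈ s, r a) := by
  classical
  induction s using Finset.induction_on with
  | empty => exact ⟨⟨0, by simp, by simp⟩, by simp⟩
  | insert a s ha ih =>
    rw [Finset.sum_insert ha, Finset.sum_insert ha]
    exact (h a (by simp)).add (ih fun b hb => h b (by simp [hb]))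

theorem convex_setOf_dotProduct_le (w : ι → ℝ) (r : ℝ) : Convex ℝ {x : ι → ℝ | w ⬝ᵥ x ≤ r} := by
  intro x hx y hy a b ha hb hab
  simp only [Set.mem_ofPred_eq, dotProduct_add, dotProduct_smul, smul_eq_mul] at *
  calc a * (w ⬝ᵥ x) + b * (w ⬝ᵥ y) ≤ a * r + b * r := by gcongr
    _ = r := by rw [← add_mul, hab, one_mul]

theorem HasMax.convexHull {w : ι → ℝ} {P : Set (ι → ℝ)} {r : ℝ} (h : HasMax w P r) :
    HasMax w (convexHull ℝ P) r := by
  obtain ⟨⟨x, hx, hxr⟩, hr⟩ := h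
  exact ⟨⟨x, subset_convexHull ℝ P hx, hxr⟩,
    fun y hy => convexHull_min (t := {x | w ⬝ᵥ x ≤ r}) hr (convex_setOf_dotProduct_le w r) hy⟩

theorem strongDual_apply_eq_dotProduct [DecidableEq ι] (l : StrongDual ℝ (ι → ℝ)) (x : ι → ℝ) :
    l x = (fun i => l (Pi.single i 1)) ⬝ᵥ x := by
  conv_lhs => rw [pi_eq_sum_univ' x]
  simp [dotProduct, mul_comm]

/-- Hahn–Banach: a point outside `Q` would be strictly separated from `Q` by some functional. -/
theorem subset_of_forall_exists_le {P Q : Set (ι → ℝ)} (hQ : IsClosed Q) (hQc : Convex ℝ Q)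
    (h : ∀ w : ι → ℝ, ∀ x ∈ P, ∃ y ∈ Q, w ⬝ᵥ x ≤ w ⬝ᵥ y) : P ⊆ Q := by
  classical
  intro x hx
  by_contra hxQ
  obtain ⟨l, c, hl, hc⟩ := geometric_hahn_banach_closed_point hQc hQ hxQ
  obtain ⟨y, hy, hxy⟩ := h (fun i => l (Pi.single i 1)) x hx
  rw [← strongDual_apply_eq_dotProduct, ← strongDual_apply_eq_dotProduct] at hxy
  linarith [hl y hy]

theorem eq_of_forall_hasMax {P Q : Set (ι → ℝ)} (hP : IsClosed P) (hPc : Convex ℝ P)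
    (hQ : IsClosed Q) (hQc : Convex ℝ Q) (h : ∀ w : ι → ℝ, ∃ r, HasMax w P r ∧ HasMax w Q r) :
    P = Q := by
  apply Set.Subset.antisymm
  · refine subset_of_forall_exists_le hQ hQc fun w x hx => ?_
    obtain ⟨r, hr, ⟨y, hy, rfl⟩, -⟩ := h w
    exact ⟨y, hy, hr.2 x hx⟩
  · refine subset_of_forall_exists_le hP hPc fun w x hx => ?_
    obtain ⟨r, ⟨⟨y, hy, rfl⟩, -⟩, hr⟩ := h w
    exact ⟨y, hy, hr.2 x hx⟩

theorem hasMax_simplexZero [DecidableEq ι] {w : ι → ℝ} {I : Finset ι} {k : ι} (hk : k ∈ I)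
    (hmax : ∀ i ∈ I, w i ≤ w k) : HasMax w (simplexZero I) (max (w k) 0) := by
  rw [simplexZero_eq]
  refine HasMax.convexHull ⟨?_, ?_⟩
  · rcases le_total (w k) 0 with h | h
    · exact ⟨0, by simp, by simp [h]⟩
    · exact ⟨Pi.single k 1, Or.inr ⟨k, hk, rfl⟩, by simp [h]⟩
  · rintro _ (rfl | ⟨i, hi, rfl⟩)
    · simp
    · simpa using Or.inl (hmax i hi)

end Support

/-! ### Functionals with a unique maximizer -/

section UniqueMax

variable {ι : Type*} [Fintype ι]

/-- The linear functional `w ⬝ᵥ ·` attains its maximum on `P` at exactly one point. -/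
def HasUniqueMax (w : ι → ℝ) (P : Set (ι → ℝ)) : Prop :=
  ∃ x ∈ P, ∀ y ∈ P, w ⬝ᵥ y < w ⬝ᵥ x ∨ y = x

theorem HasUniqueMax.add {w : ι → ℝ} {P Q : Set (ι → ℝ)} (hP : HasUniqueMax w P)
    (hQ : HasUniqueMax w Q) : HasUniqueMax w (P + Q) := by
  obtain ⟨x, hx, hP⟩ := hP
  obtain ⟨y, hy, hQ⟩ := hQ
  refine ⟨x + y, Set.add_mem_add hx hy, ?_⟩
  rintro _ ⟨a, ha, b, hb, rfl⟩
  simp only [dotProduct_add]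
  rcases hP a ha with h | rfl <;> rcases hQ b hb with h' | rfl
  · exact Or.inl (add_lt_add h h')
  · exact Or.inl (by linarith)
  · exact Or.inl (by linarith)
  · exact Or.inr rfl

theorem HasUniqueMax.smul {w : ι → ℝ} {P : Set (ι → ℝ)} {c : ℝ} (hc : 0 ≤ c)
    (hP : HasUniqueMax w P) : HasUniqueMax w (c • P) := by
  obtain ⟨x, hx, hP⟩ := hP
  refine ⟨c • x, Set.smul_mem_smul_set hx, ?_⟩
  rintro _ ⟨a, ha, rfl⟩
  rcases hc.eq_or_lt with rfl | hc
  · simp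
  rcases hP a ha with h | rfl
  · left
    simpa [dotProduct_smul] using mul_lt_mul_of_pos_left h hc
  · exact Or.inr rfl

theorem HasUniqueMax.sum {α : Type*} {w : ι → ℝ} {s : Finset α} {P : α → Set (ι → ℝ)}
    (h : ∀ a ∈ s, HasUniqueMax w (P a)) : HasUniqueMax w (∑ a ∈ s, P a) := by
  classical
  induction s using Finset.induction_on with
  | empty => exact ⟨0, by simp, by simp⟩
  | insert a s ha ih =>
    rw [Finset.sum_insert ha]
    exact (h a (by simp)).add (ih fun b hb => h b (by simp [hb]))

/-- An open half-space together with one point of its boundary is convex. -/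
theorem HasUniqueMax.convexHull {w : ι → ℝ} {P : Set (ι → ℝ)} (h : HasUniqueMax w P) :
    HasUniqueMax w (convexHull ℝ P) := by
  obtain ⟨x, hx, hP⟩ := h
  refine ⟨x, subset_convexHull ℝ P hx, fun y hy =>
    convexHull_min (t := {y | w ⬝ᵥ y < w ⬝ᵥ x ∨ y = x}) hP ?_ hy⟩
  rw [convex_iff_forall_pos]
  intro p hp q hq a b ha hb hab
  simp only [Set.mem_ofPred_eq, dotProduct_add, dotProduct_smul, smul_eq_mul] at *
  have hx' : w ⬝ᵥ x = a * (w ⬝ᵥ x) + b * (w ⬝ᵥ x) := by rw [← add_mul, hab, one_mul]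
  rcases hp with hp | rfl <;> rcases hq with hq | rfl
  · left; rw [hx']; gcongr
  · left; conv_rhs => rw [hx']
    gcongr
  · left; conv_rhs => rw [hx']
    gcongr
  · right; rw [← add_smul, hab, one_smul]

theorem hasUniqueMax_simplex [DecidableEq ι] {w : ι → ℝ} (hw : Function.Injective w)
    {I : Finset ι} (hI : I.Nonempty) : HasUniqueMax w (simplex I) := by
  obtain ⟨k, hk, hmax⟩ := I.exists_max_image w hI
  refine HasUniqueMax.convexHull ⟨Pi.single k 1, ⟨k, hk, rfl⟩, ?_⟩
  rintro _ ⟨i, hi, rfl⟩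
  by_cases hik : i = k
  · exact Or.inr (by rw [hik])
  · left
    simpa using (hmax i hi).lt_of_ne fun h => hik (hw h)

/-- If `Q + N` has a unique maximizer and the maximum on `N` is attained, then `Q` has at most one
maximizer. -/
theorem HasUniqueMax.eq_of_add {w : ι → ℝ} {Q N : Set (ι → ℝ)} {r : ℝ}
    (h : HasUniqueMax w (Q + N)) (hN : HasMax w N r) {x y : ι → ℝ} (hx : x ∈ Q) (hy : y ∈ Q)
    (hxm : ∀ z ∈ Q, w ⬝ᵥ z ≤ w ⬝ᵥ x) (hym : ∀ z ∈ Q, w ⬝ᵥ z ≤ w ⬝ᵥ y) : x = y := by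
  obtain ⟨_, ⟨p, hp, q, hq, rfl⟩, h⟩ := h
  obtain ⟨⟨z, hz, rfl⟩, hN⟩ := hN
  have key : ∀ x ∈ Q, (∀ z ∈ Q, w ⬝ᵥ z ≤ w ⬝ᵥ x) → x + z = p + q := by
    intro x hx hxm
    refine (h _ (Set.add_mem_add hx hz)).resolve_left ?_
    simp only [dotProduct_add, not_lt]
    exact add_le_add (hxm p hp) (hN q hq)
  exact add_right_cancel ((key x hx hxm).trans (key y hy hym).symm)

end UniqueMax

/-! ### Edge directions of polytopes -/

section Edges

open Filter Topology

variable {ι : Type*} [Fintype ι]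

/-- If every vector orthogonal to `d` has equal entries at `i` and `j`, then `d` is parallel to
`e_i - e_j`. -/
theorem span_singleton_eq_of_forall_orthogonal [DecidableEq ι] {d : ι → ℝ} (hd : d ≠ 0) {i j : ι}
    (hij : i ≠ j) (h : ∀ p : ι → ℝ, p ⬝ᵥ d = 0 → p i = p j) :
    Submodule.span ℝ {d} = Submodule.span ℝ {(Pi.single i 1 - Pi.single j 1 : ι → ℝ)} := by
  obtain ⟨k, hk⟩ := Function.ne_iff.mp hd
  simp only [Pi.zero_apply] at hk
  set c : ℝ := (Pi.single i 1 - Pi.single j 1 : ι → ℝ) k with hc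
  have key : d k • (Pi.single i 1 - Pi.single j 1 : ι → ℝ) = c • d := by
    ext l
    -- This test vector is orthogonal to `d`, and equality of its entries at `i` and `j` is
    -- coordinate `l` of the claim.
    have := h (d k • Pi.single l 1 - d l • Pi.single k 1)
      (by simp [sub_dotProduct, smul_dotProduct, mul_comm])
    simp only [hc, Pi.sub_apply, Pi.smul_apply, smul_eq_mul, Pi.single_apply] at this ⊢
    simp only [eq_comm (a := l), eq_comm (a := k)]
    linarith
  have hne : (Pi.single i 1 - Pi.single j 1 : ι → ℝ) ≠ 0 := by
    intro h0
    have := congrFun h0 i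
    simp [hij] at this
  have hc0 : c ≠ 0 := by
    intro h0
    rw [h0, zero_smul] at key
    exact (smul_ne_zero hk hne) key
  rw [← Submodule.span_singleton_smul_eq (IsUnit.mk0 _ hc0) d, ← key,
    Submodule.span_singleton_smul_eq (IsUnit.mk0 _ hk)]

/-- Unless `d` is parallel to some `e_i - e_j`, some vector orthogonal to `d` has distinct
entries. -/
theorem exists_orthogonal_injective {d : ι → ℝ}
    (h : ∀ i j : ι, i ≠ j → ∃ p : ι → ℝ, p ⬝ᵥ d = 0 ∧ p i ≠ p j) :
    ∃ p : ι → ℝ, p ⬝ᵥ d = 0 ∧ Function.Injective p := by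
  classical
  let W : Submodule ℝ (ι → ℝ) :=
    { carrier := {p | p ⬝ᵥ d = 0}
      add_mem' := fun {a b} ha hb => by simp_all [add_dotProduct]
      zero_mem' := by simp
      smul_mem' := fun c x hx => by simp_all [smul_dotProduct] }
  let V : {q : ι × ι // q.1 ≠ q.2} → Subspace ℝ W := fun q =>
    LinearMap.ker ((LinearMap.proj (R := ℝ) (φ := fun _ : ι => ℝ) q.1.1 -
      LinearMap.proj q.1.2).comp W.subtype)
  by_contra! hcon
  have hcover : ⋃ q, (V q : Set W) = Set.univ := by
    rw [Set.eq_univ_iff_forall]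
    rintro ⟨p, hp⟩
    have := hcon p hp
    simp only [Function.Injective, not_forall] at this
    obtain ⟨i, j, hpij, hij⟩ := this
    refine Set.mem_iUnion.2 ⟨⟨(i, j), hij⟩, ?_⟩
    simp [V, hpij]
  -- A vector space over an infinite field is not a finite union of proper subspaces, so a single
  -- equation `p i = p j` holds on all of `W`.
  obtain ⟨⟨⟨i, j⟩, hij⟩, hV⟩ := Subspace.exists_eq_top_of_iUnion_eq_univ hcover
  obtain ⟨p, hp, hpij⟩ := h i j hij
  have : (⟨p, hp⟩ : W) ∈ V ⟨(i, j), hij⟩ := by rw [hV]; trivial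
  simp only [V, LinearMap.mem_ker, LinearMap.comp_apply, LinearMap.sub_apply,
    Submodule.subtype_apply, LinearMap.proj_apply] at this
  exact hpij (sub_eq_zero.1 this)

/-- A polytope on which every functional with distinct entries has at most one maximizer is a
generalized permutohedron of type `A`. -/
theorem isTypeAGenPermutohedron_of_injective [DecidableEq ι] {P : Set (ι → ℝ)} (hP : IsPolytope P)
    (h : ∀ w : ι → ℝ, Function.Injective w → ∀ x ∈ P, ∀ y ∈ P,
      (∀ z ∈ P, w ⬝ᵥ z ≤ w ⬝ᵥ x) → (∀ z ∈ P, w ⬝ᵥ z ≤ w ⬝ᵥ y) → x = y) :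
    IsTypeAGenPermutohedron P := by
  refine ⟨hP, fun F ⟨hF, hdim⟩ => ?_⟩
  by_contra! hcon
  have hFne : F.Nonempty := by
    rw [Set.nonempty_iff_ne_empty]
    intro hFe
    rw [hFe, vectorSpan_empty, finrank_bot] at hdim
    exact zero_ne_one hdim
  obtain ⟨l, hl⟩ := hF hFne
  obtain ⟨w, hw⟩ : ∃ w : ι → ℝ, ∀ x, l x = w ⬝ᵥ x := ⟨_, strongDual_apply_eq_dotProduct l⟩
  simp only [hw] at hl
  obtain ⟨x₀, hx₀⟩ := hFne
  have hx₀' := hl ▸ hx₀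
  obtain ⟨d, hd, hspan⟩ : ∃ d : ι → ℝ, d ≠ 0 ∧ vectorSpan ℝ F = Submodule.span ℝ {d} := by
    obtain ⟨⟨d, hdm⟩, hd0, hd⟩ := finrank_eq_one_iff'.1 hdim
    refine ⟨d, by simpa using hd0, le_antisymm (fun v hv => ?_) ?_⟩
    · obtain ⟨c, hc⟩ := hd ⟨v, hv⟩
      exact Submodule.mem_span_singleton.2 ⟨c, congrArg Subtype.val hc⟩
    · rwa [Submodule.span_singleton_le_iff_mem]
  obtain ⟨p, hpd, hpinj⟩ : ∃ p : ι → ℝ, p ⬝ᵥ d = 0 ∧ Function.Injective p := by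
    refine exists_orthogonal_injective fun i j hij => ?_
    by_contra! hno
    exact hcon i j hij (hspan.trans (span_singleton_eq_of_forall_orthogonal hd hij hno))
  have hpF : ∀ x ∈ F, p ⬝ᵥ x = p ⬝ᵥ x₀ := by
    intro x hx
    have : x - x₀ ∈ vectorSpan ℝ F := vsub_mem_vectorSpan ℝ hx hx₀
    rw [hspan, Submodule.mem_span_singleton] at this
    obtain ⟨c, hc⟩ := this
    rw [← sub_eq_zero, ← dotProduct_sub, ← hc, dotProduct_smul, hpd, smul_zero]
  obtain ⟨S, hS, hPS⟩ := hP
  have hSP : S ⊆ P := hPS ▸ subset_convexHull ℝ S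
  -- Ties of `w` are broken by `p`; entries of `w` that already differ stay distinct for small `ε`.
  have hinj : ∀ᶠ ε in 𝓝[>] (0 : ℝ), ∀ i j, i ≠ j → (w + ε • p) i ≠ (w + ε • p) j := by
    refine eventually_all.2 fun i => eventually_all.2 fun j => ?_
    by_cases hij : i = j
    · simp [hij]
    by_cases hwij : w i = w j
    · filter_upwards [self_mem_nhdsWithin] with ε hε _ heq
      simp only [Pi.add_apply, Pi.smul_apply, smul_eq_mul, hwij, add_right_inj] at heq
      exact hij (hpinj (mul_left_cancel₀ (ne_of_gt hε) heq))
    · have hcont : ContinuousAt (fun ε : ℝ => w i + ε * p i - (w j + ε * p j)) 0 := by fun_prop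
      have : ∀ᶠ ε in 𝓝 (0 : ℝ), w i + ε * p i - (w j + ε * p j) ≠ 0 :=
        hcont.eventually_ne (by simpa [sub_eq_zero] using hwij)
      filter_upwards [this.filter_mono nhdsWithin_le_nhds] with ε hε _ heq
      exact hε (sub_eq_zero.2 (by simpa using heq))
  -- Generators in `F` have the same `p`-value as `x₀`; the finitely many others lie strictly below
  -- the maximum of `w` and stay there for small `ε`.
  have hmax : ∀ᶠ ε in 𝓝[>] (0 : ℝ), ∀ s ∈ S, (w + ε • p) ⬝ᵥ s ≤ (w + ε • p) ⬝ᵥ x₀ := by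
    rw [eventually_all_finite hS]
    intro s hs
    by_cases hsF : s ∈ F
    · have hs' := hl ▸ hsF
      filter_upwards with ε
      rw [add_dotProduct, add_dotProduct, smul_dotProduct, smul_dotProduct, hpF s hsF]
      gcongr
      exact hx₀'.2 s hs'.1
    · have hlt : w ⬝ᵥ s < w ⬝ᵥ x₀ := by
        by_contra! hle
        apply hsF
        rw [hl]
        exact ⟨hSP hs, fun y hy => (hx₀'.2 y hy).trans hle⟩
      have hcont : ContinuousAt (fun ε : ℝ => w ⬝ᵥ x₀ + ε * (p ⬝ᵥ x₀) -
        (w ⬝ᵥ s + ε * (p ⬝ᵥ s))) 0 := by fun_prop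
      have : ∀ᶠ ε in 𝓝 (0 : ℝ), 0 < w ⬝ᵥ x₀ + ε * (p ⬝ᵥ x₀) - (w ⬝ᵥ s + ε * (p ⬝ᵥ s)) :=
        hcont.eventually_const_lt (by simpa using hlt)
      filter_upwards [this.filter_mono nhdsWithin_le_nhds] with ε hε
      simp only [add_dotProduct, smul_dotProduct, smul_eq_mul]
      linarith
  obtain ⟨ε, hε₁, hε₂⟩ := (hinj.and hmax).exists
  have hmaxP : ∀ z ∈ P, (w + ε • p) ⬝ᵥ z ≤ (w + ε • p) ⬝ᵥ x₀ := fun z hz =>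
    convexHull_min (t := {z | (w + ε • p) ⬝ᵥ z ≤ (w + ε • p) ⬝ᵥ x₀}) hε₂
      (convex_setOf_dotProduct_le _ _) (hPS ▸ hz)
  -- All of `F` maximizes the perturbed functional, whose entries are distinct, so `F` is a point
  -- and not an edge.
  have hsub : F.Subsingleton := by
    have : ∀ x ∈ F, x = x₀ := by
      intro x hx
      have hx' := hl ▸ hx
      have heq : (w + ε • p) ⬝ᵥ x = (w + ε • p) ⬝ᵥ x₀ := by
        rw [add_dotProduct, add_dotProduct, smul_dotProduct, smul_dotProduct, hpF x hx,
          le_antisymm (hx₀'.2 x hx'.1) (hx'.2 x₀ hx₀'.1)]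
      exact h (w + ε • p) (fun i j hij => by_contra fun hne => hε₁ i j hne hij) x hx'.1 x₀ hx₀'.1
        (fun z hz => heq ▸ hmaxP z hz) hmaxP
    exact fun x hx y hy => (this x hx).trans (this y hy).symm
  rw [vectorSpan_of_subsingleton ℝ hsub] at hdim
  simp at hdim

end Edges

/-! ### Parking functions and the vertices of `PF u` -/

section Parking

variable {n : ℕ} {u : Fin n → ℝ}

/-- Pigeonhole: if the sorted entry at `i` exceeded `u i`, the indices up to `i` would be sent
injectively to sorted positions strictly below `i`. -/
theorem isParkingFunction_of_perm (hu : Monotone u) {a : Fin n → ℝ} (ha : ∀ i, 0 ≤ a i)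
    (σ : Equiv.Perm (Fin n)) (h : ∀ i, a (σ i) ≤ u i) : IsParkingFunction u a := by
  refine ⟨ha, fun i => ?_⟩
  by_contra! hlt
  have hmaps : ∀ k ∈ Finset.Iic i, (Tuple.sort a).symm (σ k) ∈ Finset.Iio i := by
    intro k hk
    rw [Finset.mem_Iic] at hk
    rw [Finset.mem_Iio]
    by_contra! hle
    have h₁ : a (Tuple.sort a i) ≤ a (Tuple.sort a ((Tuple.sort a).symm (σ k))) :=
      Tuple.monotone_sort a hle
    rw [Equiv.apply_symm_apply] at h₁
    linarith [h k, hu hk]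
  have := Finset.card_le_card_of_injOn _ hmaps
    ((Tuple.sort a).symm.injective.comp σ.injective).injOn
  simp at this

/-- The `u`-parking functions all of whose entries are `0` or entries of `u`. -/
def parkingVertices (u : Fin n → ℝ) : Set (Fin n → ℝ) :=
  {a | IsParkingFunction u a ∧ ∀ i, a i ∈ insert 0 (Set.range u)}

theorem finite_parkingVertices (u : Fin n → ℝ) : (parkingVertices u).Finite :=
  (Set.Finite.pi' fun _ => (Set.finite_range u).insert 0).subset fun _ ha => ha.2

/-- Negative weights are dropped because `a` is nonnegative; the rearrangement inequality then pairs
sorted weights with sorted entries. -/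
theorem dotProduct_le_of_isParkingFunction {a w : Fin n → ℝ}
    (ha : IsParkingFunction u a) {σ : Equiv.Perm (Fin n)} (hσ : Monotone (w ∘ σ)) :
    w ⬝ᵥ a ≤ ∑ m, max (w (σ m)) 0 * u m := by
  set τ := Tuple.sort a
  have hv : Monotone fun m => max (w (σ m)) 0 := fun i j hij => max_le_max_right 0 (hσ hij)
  calc w ⬝ᵥ a ≤ ∑ i, max (w i) 0 * a i :=
        Finset.sum_le_sum fun i _ => mul_le_mul_of_nonneg_right (le_max_left _ _) (ha.1 i)
    _ = ∑ m, max (w (σ m)) 0 * (a ∘ τ) ((σ.trans τ.symm) m) := by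
        simpa using (Equiv.sum_comp σ fun i => max (w i) 0 * a i).symm
    _ ≤ ∑ m, max (w (σ m)) 0 * (a ∘ τ) m :=
        (hv.monovary (Tuple.monotone_sort a)).sum_mul_comp_perm_le_sum_mul
    _ ≤ ∑ m, max (w (σ m)) 0 * u m :=
        Finset.sum_le_sum fun m _ => mul_le_mul_of_nonneg_left (ha.2 m) (le_max_right _ _)

theorem hasMax_parkingVertices (hu₀ : ∀ i, 0 ≤ u i) (hu : Monotone u) {w : Fin n → ℝ}
    {σ : Equiv.Perm (Fin n)} (hσ : Monotone (w ∘ σ)) :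
    HasMax w (parkingVertices u) (∑ m, max (w (σ m)) 0 * u m) := by
  -- The greedy maximizer: entries of `u` placed in the order of `w` where `w` is positive, zero
  -- elsewhere.
  refine ⟨⟨fun i => if 0 < w i then u (σ.symm i) else 0, ⟨?_, ?_⟩, ?_⟩,
    fun a ha => dotProduct_le_of_isParkingFunction ha.1 hσ⟩
  · refine isParkingFunction_of_perm hu (fun i => ?_) σ fun i => ?_
    · split_ifs
      exacts [hu₀ _, le_rfl]
    · rw [Equiv.symm_apply_apply]
      split_ifs
      exacts [le_rfl, hu₀ _]
  · intro i
    dsimp only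
    split_ifs
    exacts [Or.inr ⟨_, rfl⟩, Or.inl rfl]
  · rw [dotProduct, ← Equiv.sum_comp σ]
    refine Finset.sum_congr rfl fun m _ => ?_
    rw [Equiv.symm_apply_apply]
    split_ifs with h
    · rw [max_eq_left h.le]
    · rw [max_eq_right (not_lt.1 h), mul_zero, zero_mul]

theorem PF_eq_convexHull_parkingVertices (hu₀ : ∀ i, 0 ≤ u i) (hu : Monotone u) :
    PF u = convexHull ℝ (parkingVertices u) := by
  apply Set.Subset.antisymm
  · refine convexHull_min (subset_of_forall_exists_le
      ((finite_parkingVertices u).isCompact_convexHull (𝕜 := ℝ)).isClosed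
      (convex_convexHull ℝ _) fun w a ha => ?_) (convex_convexHull ℝ _)
    obtain ⟨⟨y, hy, hyr⟩, -⟩ := hasMax_parkingVertices hu₀ hu (Tuple.monotone_sort w)
    exact ⟨y, subset_convexHull ℝ _ hy,
      (dotProduct_le_of_isParkingFunction ha (Tuple.monotone_sort w)).trans_eq hyr.symm⟩
  · exact convexHull_mono fun a ha => ha.1

theorem isPolytope_PF (hu₀ : ∀ i, 0 ≤ u i) (hu : Monotone u) : IsPolytope (PF u) :=
  ⟨_, finite_parkingVertices u, PF_eq_convexHull_parkingVertices hu₀ hu⟩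

theorem hasMax_PF (hu₀ : ∀ i, 0 ≤ u i) (hu : Monotone u) {w : Fin n → ℝ}
    {σ : Equiv.Perm (Fin n)} (hσ : Monotone (w ∘ σ)) :
    HasMax w (PF u) (∑ m, max (w (σ m)) 0 * u m) := by
  rw [PF_eq_convexHull_parkingVertices hu₀ hu]
  exact (hasMax_parkingVertices hu₀ hu hσ).convexHull

theorem isParkingFunction_self (hu₀ : ∀ i, 0 ≤ u i) (hu : Monotone u) : IsParkingFunction u u :=
  isParkingFunction_of_perm hu hu₀ (Equiv.refl _) fun _ => le_rfl

theorem sum_Ici_le_of_mem_PF (hu₀ : ∀ i, 0 ≤ u i) (hu : Monotone u) {x : Fin n → ℝ}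
    (hx : x ∈ PF u) (k : Fin n) : ∑ i ∈ Finset.Ici k, x i ≤ ∑ i ∈ Finset.Ici k, u i := by
  -- The indicator of `Ici k` is already sorted, so the support function formula applies with the
  -- identity permutation.
  have hmono : Monotone ((fun i => if k ≤ i then (1 : ℝ) else 0) ∘ Equiv.refl (Fin n)) := by
    intro i j hij
    change (if k ≤ i then (1 : ℝ) else 0) ≤ if k ≤ j then 1 else 0
    by_cases h₁ : k ≤ i
    · rw [if_pos h₁, if_pos (h₁.trans hij)]
    · rw [if_neg h₁]
      split_ifs
      exacts [zero_le_one, le_rfl]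
  have h := (hasMax_PF hu₀ hu hmono).2 x hx
  have hsum : ∀ y : Fin n → ℝ,
      ∑ i, (if k ≤ i then (1 : ℝ) else 0) * y i = ∑ i ∈ Finset.Ici k, y i := by
    intro y
    simp only [ite_mul, one_mul, zero_mul, ← Finset.sum_filter]
    congr 1
    ext i
    simp
  rw [dotProduct, hsum] at h
  refine h.trans_eq ?_
  rw [← hsum]
  refine Finset.sum_congr rfl fun i _ => ?_
  rw [Equiv.refl_apply]
  by_cases h : k ≤ i <;> simp [h]

theorem eq_of_forall_sum_Ici_eq {x y : Fin n → ℝ}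
    (h : ∀ k, ∑ i ∈ Finset.Ici k, x i = ∑ i ∈ Finset.Ici k, y i) : x = y := by
  funext k
  have hIoi : ∑ i ∈ Finset.Ioi k, x i = ∑ i ∈ Finset.Ioi k, y i := by
    by_cases hk : (k : ℕ) + 1 < n
    · have : Finset.Ioi k = Finset.Ici ⟨k + 1, hk⟩ := by
        ext i
        rw [Finset.mem_Ioi, Finset.mem_Ici, Fin.lt_def, Fin.le_def, Nat.succ_le_iff]
      rw [this, h]
    · have : Finset.Ioi k = ∅ := by
        ext i
        simp only [Finset.mem_Ioi, Fin.lt_def, Finset.notMem_empty, iff_false]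
        omega
      simp [this]
  have hk := h k
  rw [← Finset.Ioi_insert, Finset.sum_insert (by simp), Finset.sum_insert (by simp), hIoi] at hk
  exact add_right_cancel hk

/-- The point `u` maximizes all the tail sums over `Ici k` at once, and these sums determine a
vector. -/
theorem mem_extremePoints_PF (hu₀ : ∀ i, 0 ≤ u i) (hu : Monotone u) :
    u ∈ (PF u).extremePoints ℝ := by
  refine ⟨subset_convexHull ℝ _ (isParkingFunction_self hu₀ hu), ?_⟩
  rintro x hx y hy ⟨a, b, ha, hb, hab, hxy⟩
  refine eq_of_forall_sum_Ici_eq fun k => le_antisymm (sum_Ici_le_of_mem_PF hu₀ hu hx k) ?_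
  have hy' := sum_Ici_le_of_mem_PF hu₀ hu hy k
  have hsum : ∑ i ∈ Finset.Ici k, u i =
      a * ∑ i ∈ Finset.Ici k, x i + b * ∑ i ∈ Finset.Ici k, y i := by
    rw [← hxy, Finset.mul_sum, Finset.mul_sum, ← Finset.sum_add_distrib]
    simp
  by_contra! hlt
  have h₁ := mul_lt_mul_of_pos_left hlt ha
  have h₂ := mul_le_mul_of_nonneg_left hy' hb.le
  have h₃ : ∑ i ∈ Finset.Ici k, u i =
      a * ∑ i ∈ Finset.Ici k, u i + b * ∑ i ∈ Finset.Ici k, u i := by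
    rw [← add_mul, hab, one_mul]
  linarith

end Parking

/-! ### The coefficients `y_I` as finite differences -/

section Coefficients

variable {n : ℕ}

/-- Reversing the order of summation gives the usual expansion of an iterated difference. The
extension of `u` by zero is never seen, because `|I| ≤ n`. -/
theorem coeffY_eq_fwdDiff (u : Fin n → ℝ) {I : Finset (Fin n)} {k : ℕ} (hI : I.card = k + 1) :
    coeffY u I = (fwdDiff (1 : ℕ))^[k] (fun m => if h : m < n then u ⟨m, h⟩ else 0) 0 := by
  set f : ℕ → ℝ := fun m => if h : m < n then u ⟨m, h⟩ else 0 with hf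
  have hcard := card_finset_fin_le I
  have h₁ : coeffY u I = ∑ j : Fin I.card,
      (fun j : ℕ => ((I.card - 1).choose j : ℝ) * (-1) ^ j * f (I.card - j - 1)) j := by
    refine Finset.sum_congr rfl fun j _ => ?_
    have : I.card - j - 1 < n := by have := j.isLt; omega
    simp only [hf, this, dif_pos]
  rw [h₁, Fin.sum_univ_eq_sum_range
    (fun j : ℕ => ((I.card - 1).choose j : ℝ) * (-1) ^ j * f (I.card - j - 1)), hI,
    fwdDiff_iter_eq_sum_shift, ← Finset.sum_range_reflect]
  refine Finset.sum_congr rfl fun j hj => ?_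
  have hj' : j ≤ k := by simpa [Nat.lt_succ_iff] using hj
  rw [show k + 1 - 1 - j = k - j by omega, show k + 1 - 1 = k by omega,
    show k + 1 - (k - j) - 1 = j by omega, Nat.choose_symm hj']
  simp only [zsmul_eq_mul, smul_eq_mul, mul_one, zero_add, Int.cast_mul, Int.cast_pow,
    Int.cast_neg, Int.cast_one, Int.cast_natCast]
  ring

theorem coeffY_congr (u : Fin n → ℝ) {I J : Finset (Fin n)} (h : I.card = J.card) :
    coeffY u I = coeffY u J := by
  rcases hk : I.card with _ | k
  · rw [Finset.card_eq_zero.1 hk, Finset.card_eq_zero.1 (h.symm.trans hk)]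
  · rw [coeffY_eq_fwdDiff u hk, coeffY_eq_fwdDiff u (h.symm.trans hk)]

theorem exists_int_coeffY_eq {u : Fin n → ℝ} (hu : ∀ i, ∃ k : ℤ, u i = k)
    (I : Finset (Fin n)) : ∃ k : ℤ, coeffY u I = k := by
  choose v hv using hu
  rw [coeffY]
  simp only [hv]
  exact ⟨∑ j : Fin I.card, ((I.card - 1).choose j : ℤ) * (-1) ^ (j : ℕ) * v _, by push_cast; rfl⟩

/-- Splitting off the element ranked last by `σ`; with `eq_of_insert_eq_insert` this makes nonempty
subsets correspond to pairs `(m, J)` with `J ⊆ Iio m`. -/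
theorem exists_eq_map_insert (σ : Equiv.Perm (Fin n)) {I : Finset (Fin n)} (hI : I.Nonempty) :
    ∃ m, ∃ J ∈ (Finset.Iio m).powerset, (insert m J).map σ.toEmbedding = I := by
  set K := I.map σ.symm.toEmbedding with hK
  have hKne : K.Nonempty := hI.map
  refine ⟨K.max' hKne, K.erase (K.max' hKne), ?_, ?_⟩
  · rw [Finset.mem_powerset]
    intro i hi
    rw [Finset.mem_erase] at hi
    exact Finset.mem_Iio.2 ((K.le_max' i hi.2).lt_of_ne hi.1)
  · rw [Finset.insert_erase (K.max'_mem hKne), hK]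
    ext i
    simp

theorem eq_of_insert_eq_insert {m m' : Fin n} {J J' : Finset (Fin n)}
    (hJ : J ⊆ Finset.Iio m) (hJ' : J' ⊆ Finset.Iio m') (h : insert m J = insert m' J') :
    m = m' ∧ J = J' := by
  have hle : ∀ {m m' : Fin n} {J J' : Finset (Fin n)}, J' ⊆ Finset.Iio m' →
      insert m J = insert m' J' → m ≤ m' := by
    intro m m' J J' hJ' h
    have : m ∈ insert m' J' := h ▸ Finset.mem_insert_self m J
    rcases Finset.mem_insert.1 this with h | h
    exacts [h.le, (Finset.mem_Iio.1 (hJ' h)).le]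
  obtain rfl : m = m' := le_antisymm (hle hJ' h) (hle hJ h.symm)
  refine ⟨rfl, ?_⟩
  have hm : ∀ {J : Finset (Fin n)}, J ⊆ Finset.Iio m → m ∉ J := fun hJ hmem =>
    lt_irrefl _ (Finset.mem_Iio.1 (hJ hmem))
  rw [← Finset.erase_insert (hm hJ), h, Finset.erase_insert (hm hJ')]

/-- Newton's formula: the coefficients of the sets with largest element `m` add up to `u m`. -/
theorem sum_coeffY_map_insert (u : Fin n → ℝ) (σ : Equiv.Perm (Fin n)) (m : Fin n) :
    ∑ J ∈ (Finset.Iio m).powerset, coeffY u ((insert m J).map σ.toEmbedding) = u m := by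
  set f : ℕ → ℝ := fun m => if h : m < n then u ⟨m, h⟩ else 0 with hf
  have h₁ : ∀ J ∈ (Finset.Iio m).powerset, coeffY u ((insert m J).map σ.toEmbedding) =
      (fun k => (fwdDiff (1 : ℕ))^[k] f 0) J.card := by
    intro J hJ
    refine coeffY_eq_fwdDiff u ?_
    rw [Finset.card_map, Finset.card_insert_of_notMem]
    intro hm
    exact lt_irrefl _ (Finset.mem_Iio.1 (Finset.mem_powerset.1 hJ hm))
  rw [Finset.sum_congr rfl h₁, Finset.sum_powerset_apply_card fun k => (fwdDiff 1)^[k] f 0, Fin.card_Iio,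
    ← shift_eq_sum_fwdDiff_iter]
  simp [hf]

/-- When `R` depends only on the last-ranked element, grouping the sets by that element lets
Newton's formula collapse each group. -/
theorem sum_coeffY_mul (u g : Fin n → ℝ) (σ : Equiv.Perm (Fin n)) (R : Finset (Fin n) → ℝ)
    (hR : ∀ m, ∀ J ⊆ Finset.Iio m, R ((insert m J).map σ.toEmbedding) = g m) :
    ∑ I ∈ nonemptySubsets n, coeffY u I * R I = ∑ m, g m * u m := by
  have h₁ : ∀ m, g m * u m = ∑ J ∈ (Finset.Iio m).powerset,
      coeffY u ((insert m J).map σ.toEmbedding) * R ((insert m J).map σ.toEmbedding) := by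
    intro m
    rw [← sum_coeffY_map_insert u σ m, Finset.mul_sum]
    refine Finset.sum_congr rfl fun J hJ => ?_
    rw [hR m J (Finset.mem_powerset.1 hJ), mul_comm]
  rw [Finset.sum_congr rfl fun m _ => h₁ m, Finset.sum_sigma']
  symm
  refine Finset.sum_bij (fun p _ => (insert p.1 p.2).map σ.toEmbedding) ?_ ?_ ?_ fun _ _ => rfl
  · intro p _
    simp [nonemptySubsets]
  · rintro ⟨m, J⟩ hp ⟨m', J'⟩ hp' h
    simp only [Finset.mem_sigma, Finset.mem_univ, true_and, Finset.mem_powerset] at hp hp'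
    obtain ⟨rfl, rfl⟩ := eq_of_insert_eq_insert hp hp' (Finset.map_injective _ h)
    rfl
  · intro I hI
    obtain ⟨m, J, hJ, rfl⟩ := exists_eq_map_insert σ (Finset.mem_filter.1 hI).2
    exact ⟨⟨m, J⟩, by simpa using hJ, rfl⟩

theorem sum_coeffY (u : Fin n → ℝ) : ∑ I ∈ nonemptySubsets n, coeffY u I = ∑ m, u m := by
  simpa using sum_coeffY_mul u (fun _ => 1) (Equiv.refl _) (fun _ => 1) fun _ _ _ => rfl

end Coefficients

/-! ### The signed Minkowski decomposition of `PF u` -/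

section SignedSum

variable {n : ℕ} {u : Fin n → ℝ}

theorem isSignedMinkowskiSum_PF (hu₀ : ∀ i, 0 ≤ u i) (hu : Monotone u) :
    IsSignedMinkowskiSum (PF u) (nonemptySubsets n) (coeffY u) simplexZero := by
  have hcompact : ∀ c : Finset (Fin n) → ℝ,
      IsCompact (∑ I ∈ nonemptySubsets n, c I • simplexZero I) := fun c =>
    isCompact_finsetSum fun I _ => (isPolytope_simplexZero I).isCompact.smul (c I)
  have hconvex : ∀ c : Finset (Fin n) → ℝ,
      Convex ℝ (∑ I ∈ nonemptySubsets n, c I • simplexZero I) := fun c =>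
    convex_sum _ fun I _ => (isPolytope_simplexZero I).convex.smul (c I)
  have hPF := isPolytope_PF hu₀ hu
  refine ⟨hPF, eq_of_forall_hasMax (hPF.isCompact.add (hcompact _)).isClosed
    (hPF.convex.add (hconvex _)) (hcompact _).isClosed (hconvex _) fun w => ?_⟩
  set σ := Tuple.sort w
  have hσ : Monotone (w ∘ σ) := Tuple.monotone_sort w
  have hmax : ∀ m, ∀ J ⊆ Finset.Iio m,
      HasMax w (simplexZero ((insert m J).map σ.toEmbedding)) (max (w (σ m)) 0) := by
    intro m J hJ
    refine hasMax_simplexZero (by simp) fun i hi => ?_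
    obtain ⟨j, hj, rfl⟩ := Finset.mem_map.1 hi
    rcases Finset.mem_insert.1 hj with rfl | hj
    · exact le_rfl
    · exact hσ (Finset.mem_Iio.1 (hJ hj)).le
  have hex : ∀ I ∈ nonemptySubsets n, ∃ r, HasMax w (simplexZero I) r := by
    intro I hI
    obtain ⟨m, J, hJ, rfl⟩ := exists_eq_map_insert σ (Finset.mem_filter.1 hI).2
    exact ⟨_, hmax m J (Finset.mem_powerset.1 hJ)⟩
  choose! R hR using hex
  have hsum : ∑ I ∈ nonemptySubsets n, coeffY u I * R I = ∑ m, max (w (σ m)) 0 * u m :=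
    sum_coeffY_mul u _ σ R fun m J hJ =>
      (hR _ (by simp [nonemptySubsets])).unique (hmax m J hJ)
  have hpart : ∀ c : Finset (Fin n) → ℝ, (∀ I, 0 ≤ c I) → HasMax w
      (∑ I ∈ nonemptySubsets n, c I • simplexZero I) (∑ I ∈ nonemptySubsets n, c I * R I) :=
    fun c hc => HasMax.sum fun I hI => (hR I hI).smul (hc I)
  refine ⟨_, (hasMax_PF hu₀ hu hσ).add (hpart _ fun I => le_max_right _ _), ?_⟩
  convert hpart (fun I => max (coeffY u I) 0) fun I => le_max_right _ _ using 1
  rw [← hsum, ← Finset.sum_add_distrib]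
  refine Finset.sum_congr rfl fun I _ => ?_
  rw [← add_mul]
  congr 1
  -- What remains is that a number plus its negative part is its positive part.
  rcases le_total (coeffY u I) 0 with h | h <;> simp [h]

end SignedSum

/-! ### Lifting to a hyperplane in one more dimension -/

section Lift

variable {n : ℕ}

/-- The section `x ↦ (c - ∑ x_i, x)` of the projection, with image the hyperplane where the
coordinates add up to `c`. -/
def lift (c : ℝ) : (Fin n → ℝ) →ᵃ[ℝ] (Fin (n + 1) → ℝ) where
  toFun x := Fin.cons (c - ∑ i, x i) x
  linear :=
    { toFun := fun x => Fin.cons (-∑ i, x i) x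
      map_add' := fun x y => by
        ext i
        refine Fin.cases ?_ (fun i => ?_) i
        · simp [Finset.sum_add_distrib, add_comm]
        · simp
      map_smul' := fun a x => by
        ext i
        refine Fin.cases ?_ (fun i => ?_) i
        · simp [Finset.mul_sum]
        · simp }
  map_vadd' x v := by
    ext i
    refine Fin.cases ?_ (fun i => ?_) i
    · simp [Finset.sum_add_distrib]
      ring
    · simp

theorem lift_apply (c : ℝ) (x : Fin n → ℝ) : lift c x = Fin.cons (c - ∑ i, x i) x := rfl

theorem proj_lift (c : ℝ) (x : Fin n → ℝ) : proj n (lift c x) = x := rfl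

theorem lift_add (b c : ℝ) (x y : Fin n → ℝ) : lift (b + c) (x + y) = lift b x + lift c y := by
  ext i
  refine Fin.cases ?_ (fun i => ?_) i
  · simp [lift_apply, Finset.sum_add_distrib]
    ring
  · simp [lift_apply]

theorem lift_smul (b c : ℝ) (x : Fin n → ℝ) : lift (b * c) (b • x) = b • lift c x := by
  ext i
  refine Fin.cases ?_ (fun i => ?_) i
  · simp [lift_apply, ← Finset.mul_sum, mul_sub]
  · simp [lift_apply]

theorem lift_zero_zero : lift 0 (0 : Fin n → ℝ) = 0 := by
  ext i
  refine Fin.cases ?_ (fun i => ?_) i <;> simp [lift_apply]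

theorem lift_image_add (b c : ℝ) (P Q : Set (Fin n → ℝ)) :
    lift (b + c) '' (P + Q) = lift b '' P + lift c '' Q :=
  Set.image_image2_distrib (lift_add b c)

theorem lift_image_smul (b c : ℝ) (P : Set (Fin n → ℝ)) :
    lift (b * c) '' (b • P) = b • lift c '' P := by
  rw [← Set.image_smul, ← Set.image_smul, Set.image_image, Set.image_image]
  simp only [lift_smul]

theorem lift_image_sum {α : Type*} (s : Finset α) (c : α → ℝ) (K : α → Set (Fin n → ℝ)) :
    lift (∑ a ∈ s, c a) '' (∑ a ∈ s, K a) = ∑ a ∈ s, lift (c a) '' K a := by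
  classical
  induction s using Finset.induction_on with
  | empty => simp [lift_zero_zero, Set.singleton_zero]
  | insert a s ha ih =>
    rw [Finset.sum_insert ha, Finset.sum_insert ha, Finset.sum_insert ha, lift_image_add, ih]

theorem lift_one_single (i : Fin n) : lift 1 (Pi.single i 1 : Fin n → ℝ) = Pi.single i.succ 1 := by
  ext j
  refine Fin.cases ?_ (fun j => ?_) j
  · simp [lift_apply]
  · simp [lift_apply, Pi.single_apply]

theorem lift_one_zero : lift 1 (0 : Fin n → ℝ) = Pi.single 0 1 := by
  ext j
  refine Fin.cases ?_ (fun j => ?_) j <;> simp [lift_apply]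

theorem lift_image_simplexZero (I : Finset (Fin n)) :
    lift 1 '' simplexZero I = simplex (withZero I) := by
  rw [simplexZero_eq, AffineMap.image_convexHull, simplex, withZero, Finset.coe_insert,
    Set.image_insert_eq, Set.image_insert_eq, Finset.coe_image, Set.image_image, Set.image_image,
    lift_one_zero]
  simp only [lift_one_single]

theorem IsPolytope.lift {P : Set (Fin n → ℝ)} (h : IsPolytope P) (c : ℝ) :
    IsPolytope (lift c '' P) := by
  obtain ⟨S, hS, rfl⟩ := h
  exact ⟨_, hS.image _, AffineMap.image_convexHull _ _⟩

/-- The levels balance: `∑ y_I` plus the sum of the negative parts is the sum of the positive parts.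
-/
theorem IsSignedMinkowskiSum.lift {P : Set (Fin n → ℝ)} {s : Finset (Finset (Fin n))}
    {y : Finset (Fin n) → ℝ} (h : IsSignedMinkowskiSum P s y simplexZero) :
    IsSignedMinkowskiSum (lift (∑ I ∈ s, y I) '' P) s y fun I => simplex (withZero I) := by
  refine ⟨h.1.lift _, ?_⟩
  have hsum : ∀ c : Finset (Fin n) → ℝ, ∑ I ∈ s, c I • simplex (withZero I) =
      ParkingPolytope.lift (∑ I ∈ s, c I) '' ∑ I ∈ s, c I • simplexZero I := by
    intro c
    rw [lift_image_sum]
    refine Finset.sum_congr rfl fun I _ => ?_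
    rw [← lift_image_simplexZero, ← lift_image_smul, mul_one]
  rw [hsum, hsum, ← lift_image_add, h.2, ← Finset.sum_add_distrib]
  congr 3
  refine Finset.sum_congr rfl fun I _ => ?_
  rcases le_total (y I) 0 with h | h <;> simp [h]

/-- Every summand on either side has a unique maximizer, so `HasUniqueMax.eq_of_add` cancels the
negative part. -/
theorem isTypeAGenPermutohedron_of_isSignedMinkowskiSum {Q : Set (Fin (n + 1) → ℝ)}
    {s : Finset (Finset (Fin n))} {y : Finset (Fin n) → ℝ}
    (h : IsSignedMinkowskiSum Q s y fun I => simplex (withZero I)) :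
    IsTypeAGenPermutohedron Q := by
  refine isTypeAGenPermutohedron_of_injective h.1 fun w hw p hp q hq hpm hqm => ?_
  have hsum : ∀ c : Finset (Fin n) → ℝ, (∀ I, 0 ≤ c I) →
      HasUniqueMax w (∑ I ∈ s, c I • simplex (withZero I)) := fun c hc =>
    HasUniqueMax.sum fun I _ =>
      (hasUniqueMax_simplex hw ⟨0, Finset.mem_insert_self _ _⟩).smul (hc I)
  have h₁ := hsum _ fun I => le_max_right (y I) 0
  rw [← h.2] at h₁
  obtain ⟨x, hx, hxm⟩ := hsum _ fun I => le_max_right (-y I) 0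
  refine h₁.eq_of_add (r := w ⬝ᵥ x) ⟨⟨x, hx, rfl⟩, fun z hz => ?_⟩ hp hq hpm hqm
  rcases hxm z hz with h | rfl
  exacts [h.le, le_rfl]

theorem coe_affineSpan_lift_image (c : ℝ) (P : Set (Fin n → ℝ)) :
    (affineSpan ℝ (lift c '' P) : Set (Fin (n + 1) → ℝ)) = lift c '' affineSpan ℝ P := by
  rw [← AffineSubspace.map_span, AffineSubspace.coe_map]

theorem lift_mem_latticePoints_iff {c : ℝ} (hc : ∃ k : ℤ, c = k) {x : Fin n → ℝ} :
    lift c x ∈ latticePoints (Fin (n + 1)) ↔ x ∈ latticePoints (Fin n) := by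
  constructor
  · intro h i
    simpa [lift_apply] using h i.succ
  · intro h i
    obtain ⟨k, rfl⟩ := hc
    choose v hv using h
    refine Fin.cases ⟨k - ∑ i, v i, ?_⟩ (fun i => ⟨v i, ?_⟩) i
    · simp [lift_apply, hv]
    · simp [lift_apply, hv]

theorem bijOn_lift (c : ℝ) (A : Set (Fin n → ℝ)) : Set.BijOn (lift c) A (lift c '' A) :=
  (Function.LeftInverse.injective (proj_lift c)).injOn.bijOn_image

theorem bijOn_proj (c : ℝ) (A : Set (Fin n → ℝ)) : Set.BijOn (proj n) (lift c '' A) A := by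
  refine ⟨?_, ?_, fun x hx => ⟨lift c x, ⟨x, hx, rfl⟩, proj_lift c x⟩⟩
  · rintro _ ⟨x, hx, rfl⟩
    rwa [proj_lift]
  · rintro _ ⟨x, -, rfl⟩ _ ⟨y, -, rfl⟩ h
    rw [proj_lift, proj_lift] at h
    rw [h]

theorem affineSpan_lift_image_inter_latticePoints {c : ℝ} (hc : ∃ k : ℤ, c = k)
    (P : Set (Fin n → ℝ)) :
    (affineSpan ℝ (lift c '' P) : Set (Fin (n + 1) → ℝ)) ∩ latticePoints (Fin (n + 1)) =
      lift c '' (affineSpan ℝ P ∩ latticePoints (Fin n)) := by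
  rw [coe_affineSpan_lift_image]
  ext z
  constructor
  · rintro ⟨⟨x, hx, rfl⟩, hz⟩
    exact ⟨x, ⟨hx, (lift_mem_latticePoints_iff hc).1 hz⟩, rfl⟩
  · rintro ⟨x, ⟨hx, hxl⟩, rfl⟩
    exact ⟨⟨x, hx, rfl⟩, (lift_mem_latticePoints_iff hc).2 hxl⟩

theorem proj_image_lift_image (c : ℝ) (P : Set (Fin n → ℝ)) : proj n '' (lift c '' P) = P :=
  (bijOn_proj c P).image_eq

theorem isIntegralEquivalence_proj {c : ℝ} (hc : ∃ k : ℤ, c = k) (P : Set (Fin n → ℝ)) :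
    IsIntegralEquivalence (proj n) (lift c '' P) P := by
  refine ⟨?_, proj_image_lift_image c P, ?_⟩
  · rw [coe_affineSpan_lift_image]
    exact bijOn_proj c _
  · rw [affineSpan_lift_image_inter_latticePoints hc]
    exact bijOn_proj c _

theorem isIntegralEquivalence_lift {c : ℝ} (hc : ∃ k : ℤ, c = k) (P : Set (Fin n → ℝ)) :
    IsIntegralEquivalence (lift c) P (lift c '' P) := by
  refine ⟨?_, rfl, ?_⟩
  · rw [coe_affineSpan_lift_image]
    exact bijOn_lift c _
  · rw [affineSpan_lift_image_inter_latticePoints hc]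
    exact bijOn_lift c _

/-- The injective affine map `lift c` reflects extreme points, and an integral level makes the extra
coordinate integral. -/
theorem IsIntegralPolytope.lift {c : ℝ} (hc : ∃ k : ℤ, c = k) {P : Set (Fin n → ℝ)}
    (hP : IsIntegralPolytope P) : IsIntegralPolytope (lift c '' P) := by
  refine ⟨hP.1.lift c, ?_⟩
  rintro _ ⟨⟨x, hx, rfl⟩, hext⟩
  refine (lift_mem_latticePoints_iff hc).2 (hP.2 ⟨hx, fun y hy z hz hxyz => ?_⟩)
  refine Function.LeftInverse.injective (proj_lift c) (hext ⟨y, hy, rfl⟩ ⟨z, hz, rfl⟩ ?_)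
  rw [← image_openSegment]
  exact ⟨x, hxyz, rfl⟩

end Lift

end ParkingPolytope

/-! ### The main theorem -/

theorem mainTheorem9 {n : ℕ} (u : Fin n → ℝ) (hu_nonneg : ∀ i, 0 ≤ u i) (hu_mono : Monotone u) :
    ParkingPolytope.IsSignedMinkowskiSum (ParkingPolytope.PF u)
        (ParkingPolytope.nonemptySubsets n) (ParkingPolytope.coeffY u)
        ParkingPolytope.simplexZero ∧
      (∀ I J : Finset (Fin n), I.card = J.card →
        ParkingPolytope.coeffY u I = ParkingPolytope.coeffY u J) ∧
      ∃ Q : Set (Fin (n + 1) → ℝ),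
        ParkingPolytope.IsSignedMinkowskiSum Q
            (ParkingPolytope.nonemptySubsets n) (ParkingPolytope.coeffY u)
            (fun I => ParkingPolytope.simplex (ParkingPolytope.withZero I)) ∧
          ParkingPolytope.IsTypeAGenPermutohedron Q ∧
          ParkingPolytope.proj n '' Q = ParkingPolytope.PF u ∧
          Set.BijOn (ParkingPolytope.proj n) (affineSpan ℝ Q)
            (affineSpan ℝ (ParkingPolytope.PF u)) ∧
          (ParkingPolytope.IsIntegralPolytope (ParkingPolytope.PF u) →
            (∀ I : Finset (Fin n), ∃ k : ℤ, ParkingPolytope.coeffY u I = k) ∧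
              ParkingPolytope.IsIntegralEquivalence (ParkingPolytope.proj n) Q
                (ParkingPolytope.PF u) ∧
              ParkingPolytope.IntegrallyEquivalent (ParkingPolytope.PF u) Q) := by
  open ParkingPolytope in
  have hPF := isSignedMinkowskiSum_PF hu_nonneg hu_mono
  have hQ := hPF.lift
  -- The level `∑ y_I` equals `∑ u_i`, which makes its integrality visible once `u` is integral.
  rw [sum_coeffY] at hQ
  refine ⟨hPF, fun I J => coeffY_congr u, lift (∑ i, u i) '' PF u, hQ,
    isTypeAGenPermutohedron_of_isSignedMinkowskiSum hQ, proj_image_lift_image _ _, ?_,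
    fun hint => ?_⟩
  · rw [coe_affineSpan_lift_image]
    exact bijOn_proj _ _
  · have hu : ∀ i, ∃ k : ℤ, u i = k := hint.2 (mem_extremePoints_PF hu_nonneg hu_mono)
    have hc : ∃ k : ℤ, ∑ i, u i = k := by
      choose v hv using hu
      exact ⟨∑ i, v i, by simp [hv]⟩
    exact ⟨exists_int_coeffY_eq hu, isIntegralEquivalence_proj hc _,
      hint, hint.lift hc, lift (∑ i, u i), isIntegralEquivalence_lift hc _⟩
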